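/- Let $\{0,1\}^*$ be the set of finite binary strings. For $f:\{0,1\}^*\to\{0,1\}$ let $\bar f(x)$ be the string $x$ with the token $f(x)$ appended, and for $T\in\mathbb{N}_+$ let $f^{\mathrm{e2e}\text{-}T}(x)$ be the last token of $\bar f\circ\cdots\circ\bar f\,(x)$ ($T$ applications). For a base class $\mathcal F\subseteq\{0,1\}^{\{0,1\}^*}$ put $\mathrm{e2e}^T(\mathcal F)=\{f^{\mathrm{e2e}\text{-}T}: f\in\mathcal F\}$, and let $\mathrm{VCdim}\in\mathbb{N}\cup\{\infty\}$ denote the Vapnik–Chervonenkis dimension (the supremum of the sizes of shattered finite sets). A learning rule $A$ maps finite sequences of pairs in $\{0,1\}^*\times\{0,1\}$ to functions $\{0,1\}^*\to\{0,1\}$. It *learns $\mathrm{e2e}^T(\mathcal F)$ end-to-end with sample complexity $m(\varepsilon,\delta)\in\mathbb{N}$* if for every probability distribution $\mathcal D$ on $\{0,1\}^*$, every $f_*\in\mathcal F$ and all $0<\varepsilon,\delta<1$, with probability at least $1-\delta$ over $x_1,\dots,x_m\sim\mathcal D$ i.i.d., $m=m(\varepsilon,\delta)$, the predictor $h=A\big((x_i,f_*^{\mathrm{e2e}\text{-}T}(x_i))_{i\le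 m}\big)$ satisfies $\Pr_{x\sim\mathcal D}\big(h(x)\ne f_*^{\mathrm{e2e}\text{-}T}(x)\big)\le\varepsilon$. The rule $A$ *implements $\mathrm{Cons}_{\mathrm{e2e}}$* if, for every sample $S$ for which some $f\in\mathcal F$ satisfies $f^{\mathrm{e2e}\text{-}T}(x)=y$ for all $(x,y)\in S$, it returns $A(S)=\hat f^{\,\mathrm{e2e}\text{-}T}$ for some $\hat f\in\mathcal F$ with this property. **Theorem.** 1. For every $\mathcal F\subseteq\{0,1\}^{\{0,1\}^*}$ and $T\in\mathbb{N}_+$, $$\mathrm{VCdim}(\mathrm{e2e}^T(\mathcal F))\le 6\,T\cdot\mathrm{VCdim}(\mathcal F).$$ 2. For every $\varepsilon_0\in(0,1)$ there is a constant $c>0$, depending on $\varepsilon_0$ only, such that for every $\mathcal F\subseteq\{0,1\}^{\{0,1\}^*}$ with $\mathrm{VCdim}(\mathcal F)<\infty$ and every $T\in\mathbb{N}_+$ there is a function $m(\varepsilon,\delta)$ with $$m(\varepsilon,\delta)\le \frac{c}{\varepsilon}\Big(T\cdot\mathrm{VCdim}(\mathcal F)\,\log\frac1\varepsilon+\log\frac1\delta\Big)\qquad\text{for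 all }0<\varepsilon\le\varepsilon_0,\ 0<\delta<1,$$ such that rules implementing $\mathrm{Cons}_{\mathrm{e2e}}$ exist and every such rule learns $\mathrm{e2e}^T(\mathcal F)$ end-to-end with sample complexity $m(\varepsilon,\delta)$. -/

import Mathlib

open MeasureTheory

noncomputable section

namespace AutoregressiveCoT

/-- The apply-and-append map `x ↦ append (x, f x)` of a next-token generator `f : Σ* → Σ`. -/
def applyAppend {α : Type*} (f : List α → α) (x : List α) : List α := x ++ [f x]

/-- The `T`-step chain of thought: `T` iterations of the apply-and-append map. -/
def chainOfThought {α : Type*} (f : List α → α) (T : ℕ) (x : List α) : List α :=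
  (applyAppend f)^[T] x

theorem chainOfThought_ne_nil {α : Type*} (f : List α → α) (T : ℕ+) (x : List α) :
    chainOfThought f T x ≠ [] := by
  obtain ⟨n, hn⟩ := Nat.exists_eq_succ_of_ne_zero T.ne_zero
  unfold chainOfThought
  rw [hn, Function.iterate_succ_apply']
  simp [applyAppend]

/-- The end-to-end map of `f`: the last token of its `T`-step chain of thought. -/
def endToEnd {α : Type*} (f : List α → α) (T : ℕ+) (x : List α) : α :=
  (chainOfThought f T x).getLast (chainOfThought_ne_nil f T x)

/-- The end-to-end class of a base class `F`. -/
def endToEndClass {α : Type*} (F : Set (List α → α)) (T : ℕ+) : Set (List α → α) :=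
  {h | ∃ f ∈ F, h = endToEnd f T}

/-- `H` shatters the finite set `S`: every labelling of the points of `S` is realized by some
`h ∈ H`. -/
def Shatters {X : Type*} (H : Set (X → Bool)) (S : Finset X) : Prop :=
  ∀ b : S → Bool, ∃ h ∈ H, ∀ x : S, h x = b x

/-- The VC dimension: the supremum of the sizes of the shattered finite sets, `⊤` if these sizes
are unbounded. -/
def VCdim {X : Type*} (H : Set (X → Bool)) : ℕ∞ :=
  ⨆ (S : Finset X) (_ : Shatters H S), (S.card : ℕ∞)

/-- Every set of finite binary strings is measurable. -/
instance instMeasurableSpaceStrings : MeasurableSpace (List Bool) := ⊤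

/-- A learning rule maps a finite sequence of labelled inputs to a predictor. -/
abbrev LearningRule : Type := List (List Bool × Bool) → (List Bool → Bool)

/-- The sample `((x₁, y₁), …, (xₘ, yₘ))` with labels `yᵢ` given by the end-to-end map of `f`. -/
def labelledSample (f : List Bool → Bool) (T : ℕ+) {m : ℕ} (x : Fin m → List Bool) :
    List (List Bool × Bool) :=
  List.ofFn fun i => (x i, endToEnd f T (x i))

/-- The population error `P_{x ∼ D} (h x ≠ endToEnd f T x)`. -/
def populationError (D : Measure (List Bool)) (f : List Bool → Bool) (T : ℕ+)
    (h : List Bool → Bool) : ℝ :=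
  D.real {x | h x ≠ endToEnd f T x}

/-- The rule `A` learns the end-to-end class of `F` with sample complexity `m`, in the realizable
end-to-end setting: for every distribution `D` on strings, every `f ∈ F` and all
`ε, δ ∈ (0, 1)`, with probability at least `1 - δ` over `m ε δ` i.i.d. inputs labelled by the
end-to-end map of `f`, the output of `A` has population error at most `ε`. -/
def LearnsEndToEnd (F : Set (List Bool → Bool)) (T : ℕ+) (A : LearningRule)
    (m : ℝ → ℝ → ℕ) : Prop :=
  ∀ (D : Measure (List Bool)) [IsProbabilityMeasure D], ∀ f ∈ F, ∀ ε δ : ℝ,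
    0 < ε → ε < 1 → 0 < δ → δ < 1 →
      1 - δ ≤ (Measure.pi fun _ : Fin (m ε δ) => D).real
        {x | populationError D f T (A (labelledSample f T x)) ≤ ε}

/-- `A` implements the consistency rule: on each sample `S` that is consistent with the
end-to-end map of some member of `F`, it returns the end-to-end map of some `f' ∈ F` that is
consistent with `S`. Its output on other samples is unconstrained. -/
def IsConsRule (F : Set (List Bool → Bool)) (T : ℕ+) (A : LearningRule) : Prop :=
  ∀ S : List (List Bool × Bool),
    (∃ f ∈ F, ∀ p ∈ S, endToEnd f T p.1 = p.2) →
      ∃ f' ∈ F, A S = endToEnd f' T ∧ ∀ p ∈ S, endToEnd f' T p.1 = p.2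

end AutoregressiveCoT

end

/-!
The labels `endToEnd f T x` of the points `x` of a finite set `S` are determined by the values of
`f` on the at most `2 ^ T * #S` strings that extend some `x ∈ S` by less than `T` tokens. Hence the
end-to-end class has at most as many traces on `S` as `F` has on these strings, and Sauer–Shelah
bounds their number by `exp (a * 2 ^ T * #S - d * log a)` for every `0 < a ≤ 1`, where `d` is the
VC dimension of `F`. With `a = 2 ^ (-(T + 3))` this is less than `2 ^ #S` unless `#S ≤ 6 * T * d`.

A consistent rule can only fail if some disagreement set of measure more than `ε` is missed by the
sample. By symmetrization, the probability of this is at most twice that of missing such a set with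
the sample while hitting it at least `ε * m / 4` times with an independent ghost sample. For fixed
pairs of points, exchanged independently at random, a fixed set does so with probability at most
`2 ^ (-ε * m / 4)`, and only its trace on the `2 * m` points matters. Sauer–Shelah with `a = ε / 32`
bounds the number of traces by `exp (ε * m / 16 + d * log (32 / ε))`, now with `d` the VC dimension
of the end-to-end class, which is why no `log m` enters the sample size.
-/

namespace AutoregressiveCoT

open Finset

open scoped Classical in
/-- The traces on `S` of the members of `H`, each encoded as the set of points of `S` at which it
is `true`. Their number is the growth function of `H` at `S`. -/
noncomputable def traces {X : Type*} (H : Set (X → Bool)) (S : Finset X) : Finset (Finset X) :=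
  {A ∈ S.powerset | ∃ h ∈ H, {x ∈ S | h x = true} = A}

section Traces

variable {X Y : Type*} {H : Set (X → Bool)} {S A : Finset X}

theorem mem_traces : A ∈ traces H S ↔ ∃ h ∈ H, {x ∈ S | h x = true} = A := by
  simp only [traces, mem_filter, mem_powerset, and_iff_right_iff_imp]
  rintro ⟨h, -, rfl⟩
  exact filter_subset _ _

theorem subset_of_mem_traces (hA : A ∈ traces H S) : A ⊆ S := by
  obtain ⟨h, -, rfl⟩ := mem_traces.1 hA
  exact filter_subset _ _

theorem Shatters.card_le_VCdim (h : Shatters H S) : (#S : ℕ∞) ≤ VCdim H :=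
  le_iSup₂_of_le (f := fun (S : Finset X) (_ : Shatters H S) => (#S : ℕ∞)) S h le_rfl

theorem VCdim_le {n : ℕ∞} (h : ∀ S, Shatters H S → (#S : ℕ∞) ≤ n) : VCdim H ≤ n :=
  iSup₂_le h

theorem Shatters.two_pow_card_le_card_traces (hS : Shatters H S) : 2 ^ #S ≤ #(traces H S) := by
  classical
  rw [← card_powerset]
  refine card_le_card fun A hA => ?_
  obtain ⟨h, hH, hb⟩ := hS fun x => decide ((x : X) ∈ A)
  refine mem_traces.2 ⟨h, hH, ext fun x => ?_⟩
  rw [mem_filter]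
  refine ⟨fun ⟨hx, hhx⟩ => ?_, fun hx => ?_⟩
  · simpa [hhx] using hb ⟨x, hx⟩
  · have hxS := mem_powerset.1 hA hx
    exact ⟨hxS, by simpa [hx] using hb ⟨x, hxS⟩⟩

open scoped Classical in
theorem shatters_of_traces_shatters {s : Finset X} (hs : (traces H S).Shatters s) :
    s ⊆ S ∧ Shatters H s := by
  have hsS : s ⊆ S := by
    obtain ⟨A, hA, hsA⟩ := hs.exists_superset
    exact hsA.trans (subset_of_mem_traces hA)
  refine ⟨hsS, fun b => ?_⟩
  obtain ⟨A, hA, hsA⟩ := hs (t := {x ∈ s | ∃ hx : x ∈ s, b ⟨x, hx⟩ = true}) (filter_subset _ _)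
  obtain ⟨h, hH, rfl⟩ := mem_traces.1 hA
  refine ⟨h, hH, fun x => Bool.eq_iff_iff.2 ?_⟩
  have hx := Finset.ext_iff.1 hsA x
  simpa only [mem_inter, mem_filter, x.2, hsS x.2, true_and, exists_true_left] using hx

theorem card_traces_image_le {F : Set (Y → Bool)} {Φ : (Y → Bool) → X → Bool} {R : Finset Y}
    (hΦ : ∀ f g, (∀ y ∈ R, f y = g y) → ∀ x ∈ S, Φ f x = Φ g x) :
    #(traces (Φ '' F) S) ≤ #(traces F R) := by
  have hsource : ∀ A ∈ traces (Φ '' F) S, ∃ f ∈ F, {x ∈ S | Φ f x = true} = A := fun A hA => by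
    simpa only [mem_traces, Set.exists_mem_image] using hA
  choose! φ hφF hφ using hsource
  refine card_le_card_of_injOn (fun A => {y ∈ R | φ A y = true})
    (fun A hA => mem_traces.2 ⟨φ A, hφF A hA, rfl⟩) fun A hA B hB hAB => ?_
  have hφAB : ∀ y ∈ R, φ A y = φ B y := fun y hy =>
    Bool.eq_iff_iff.2 (filter_inj'.1 hAB hy)
  rw [← hφ A hA, ← hφ B hB]
  exact filter_congr fun x hx => by rw [hΦ _ _ hφAB x hx]

/-- Each subset `s` is weighted by `a ^ #s * a⁻¹ ^ d`, which is at least `1` when `#s ≤ d`. -/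
theorem card_powerset_filter_card_le (S : Finset X) (d : ℕ) {a : ℝ} (ha : 0 < a) (ha1 : a ≤ 1) :
    (#{s ∈ S.powerset | #s ≤ d} : ℝ) ≤ Real.exp (a * #S - d * Real.log a) := by
  have hexp : Real.exp (-(d * Real.log a)) = (a ^ d)⁻¹ := by
    rw [Real.exp_neg, mul_comm, Real.exp_mul, Real.exp_log ha, Real.rpow_natCast]
  calc (#{s ∈ S.powerset | #s ≤ d} : ℝ)
      = ∑ s ∈ S.powerset with #s ≤ d, 1 := by simp
    _ ≤ ∑ s ∈ S.powerset with #s ≤ d, a ^ #s * (a ^ d)⁻¹ := by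
        refine sum_le_sum fun s hs => ?_
        rw [← div_eq_mul_inv, one_le_div (by positivity)]
        exact pow_le_pow_of_le_one ha.le ha1 (mem_filter.1 hs).2
    _ ≤ ∑ s ∈ S.powerset, a ^ #s * (a ^ d)⁻¹ :=
        sum_le_sum_of_subset_of_nonneg (filter_subset _ _) fun s _ _ => by positivity
    _ = (1 + a) ^ #S * (a ^ d)⁻¹ := by
        rw [← sum_mul, ← prod_const, prod_one_add]
        simp only [prod_const]
    _ ≤ Real.exp a ^ #S * (a ^ d)⁻¹ := by
        gcongr
        rw [add_comm]
        exact Real.add_one_le_exp a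
    _ = Real.exp (a * #S - d * Real.log a) := by
        rw [sub_eq_add_neg, Real.exp_add, hexp, mul_comm a, Real.exp_nat_mul]

/-- The Sauer–Shelah lemma; the choice `a = d / #S` gives the usual bound `(e * #S / d) ^ d`. -/
theorem card_traces_le_exp {d : ℕ} (hd : VCdim H ≤ d) {a : ℝ} (ha : 0 < a) (ha1 : a ≤ 1) :
    (#(traces H S) : ℝ) ≤ Real.exp (a * #S - d * Real.log a) := by
  classical
  refine le_trans ?_ (card_powerset_filter_card_le S d ha ha1)
  suffices (traces H S).shatterer ⊆ {s ∈ S.powerset | #s ≤ d} by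
    exact_mod_cast (card_le_card_shatterer _).trans (card_le_card this)
  intro s hs
  obtain ⟨hsS, hshat⟩ := shatters_of_traces_shatters (mem_shatterer.1 hs)
  rw [mem_filter, mem_powerset]
  exact ⟨hsS, by exact_mod_cast hshat.card_le_VCdim.trans hd⟩

theorem subsingleton_of_VCdim_eq_zero (hH : VCdim H = 0) : H.Subsingleton := by
  intro f hf g hg
  by_contra hne
  obtain ⟨x, hx⟩ := Function.ne_iff.1 hne
  have hshat : Shatters H {x} := by
    intro b
    obtain hb | hb : f x = b ⟨x, mem_singleton_self x⟩ ∨ g x = b ⟨x, mem_singleton_self x⟩ := by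
      generalize b _ = c
      revert hx
      cases f x <;> cases g x <;> cases c <;> simp
    · exact ⟨f, hf, by rintro ⟨y, hy⟩; obtain rfl := mem_singleton.1 hy; exact hb⟩
    · exact ⟨g, hg, by rintro ⟨y, hy⟩; obtain rfl := mem_singleton.1 hy; exact hb⟩
  simpa [hH] using hshat.card_le_VCdim

end Traces

section ChainOfThought

variable {α : Type*} {f g : List α → α} {x : List α}

theorem chainOfThought_succ (f : List α → α) (n : ℕ) (x : List α) :
    chainOfThought f (n + 1) x = chainOfThought f n x ++ [f (chainOfThought f n x)] :=
  Function.iterate_succ_apply' _ _ _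

theorem exists_chainOfThought_eq_append (f : List α → α) (n : ℕ) (x : List α) :
    ∃ w : List α, w.length = n ∧ chainOfThought f n x = x ++ w := by
  induction n with
  | zero => exact ⟨[], rfl, (List.append_nil x).symm⟩
  | succ n ih =>
    obtain ⟨w, hw, hchain⟩ := ih
    exact ⟨w ++ [f (x ++ w)], by simp [hw], by rw [chainOfThought_succ, hchain, List.append_assoc]⟩

theorem chainOfThought_congr {n : ℕ} (h : ∀ w : List α, w.length < n → f (x ++ w) = g (x ++ w)) :
    chainOfThought f n x = chainOfThought g n x := by
  induction n with
  | zero => rfl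
  | succ n ih =>
    obtain ⟨w, hw, hchain⟩ := exists_chainOfThought_eq_append f n x
    have hn := ih fun w hw => h w (hw.trans n.lt_succ_self)
    rw [chainOfThought_succ, chainOfThought_succ, ← hn, hchain, h w (hw.trans_lt n.lt_succ_self)]

theorem endToEnd_congr {T : ℕ+} (h : ∀ w : List α, w.length < T → f (x ++ w) = g (x ++ w)) :
    endToEnd f T x = endToEnd g T x := by
  simp only [endToEnd, chainOfThought_congr h]

theorem endToEndClass_eq_image (F : Set (List α → α)) (T : ℕ+) :
    endToEndClass F T = (endToEnd · T) '' F := by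
  ext h
  simp only [endToEndClass, Set.mem_image, Set.mem_ofPred_eq, eq_comm]

variable [Fintype α]

/-- The strings of length less than `n` over a finite alphabet. -/
noncomputable def shortStrings (α : Type*) [Fintype α] (n : ℕ) : Finset (List α) :=
  (List.finite_length_lt α n).toFinset

theorem mem_shortStrings {n : ℕ} {w : List α} : w ∈ shortStrings α n ↔ w.length < n := by
  simp [shortStrings]

theorem card_shortStrings_lt [Nontrivial α] (n : ℕ) :
    #(shortStrings α n) < Fintype.card α ^ n := by
  classical
  have hcover : shortStrings α n ⊆ (range n).biUnion fun k =>
      univ.image (List.Vector.toList : List.Vector α k → List α) := by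
    intro w hw
    simp only [mem_biUnion, mem_range, mem_image, mem_univ, true_and]
    exact ⟨w.length, mem_shortStrings.1 hw, ⟨w, rfl⟩, rfl⟩
  calc #(shortStrings α n)
      ≤ ∑ k ∈ range n, #(univ.image (List.Vector.toList : List.Vector α k → List α)) :=
        (card_le_card hcover).trans card_biUnion_le
    _ ≤ ∑ k ∈ range n, Fintype.card α ^ k :=
        sum_le_sum fun k _ => card_image_le.trans_eq (card_vector k)
    _ < Fintype.card α ^ n := Nat.geomSum_lt Fintype.one_lt_card fun k hk => mem_range.1 hk

open scoped Classical in
/-- A superset, independent of the generator, of the strings on which a generator is evaluated in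
`T` steps started from the points of `S`. -/
noncomputable def reachable (S : Finset (List α)) (T : ℕ) : Finset (List α) :=
  image₂ (· ++ ·) S (shortStrings α T)

theorem card_reachable_le [Nontrivial α] (S : Finset (List α)) (T : ℕ) :
    #(reachable S T) ≤ #S * Fintype.card α ^ T := by
  classical
  exact (card_image₂_le _ _ _).trans (Nat.mul_le_mul_left _ (card_shortStrings_lt T).le)

theorem endToEnd_congr_of_reachable {S : Finset (List α)} {T : ℕ+}
    (h : ∀ y ∈ reachable S T, f y = g y) (hx : x ∈ S) : endToEnd f T x = endToEnd g T x :=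
  endToEnd_congr fun w hw => h (x ++ w) <| by
    classical exact mem_image₂_of_mem hx (mem_shortStrings.2 hw)

end ChainOfThought

/-- The Sauer–Shelah lemma is applied with `a = 2 ^ (-(T + 3))`, so that the at most `2 ^ T * #S`
reachable strings contribute only `#S / 8` to the exponent. -/
theorem card_le_of_shatters_endToEndClass {F : Set (List Bool → Bool)} {T : ℕ+} {d : ℕ}
    (hd : VCdim F ≤ d) {S : Finset (List Bool)} (hS : Shatters (endToEndClass F T) S) :
    #S ≤ 6 * T * d := by
  set a : ℝ := (2 ^ ((T : ℕ) + 3))⁻¹ with ha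
  have hgrowth : (2 : ℝ) ^ #S ≤ Real.exp (a * #(reachable S T) - d * Real.log a) := by
    refine le_trans ?_ (card_traces_le_exp hd (by positivity)
      (inv_le_one_of_one_le₀ (one_le_pow₀ one_le_two)))
    rw [endToEndClass_eq_image] at hS
    exact_mod_cast hS.two_pow_card_le_card_traces.trans
      (card_traces_image_le fun f g h x => endToEnd_congr_of_reachable h)
  have hreach : a * #(reachable S T) ≤ #S / 8 := by
    have hcard : (#(reachable S T) : ℝ) ≤ #S * 2 ^ (T : ℕ) := by
      exact_mod_cast card_reachable_le S T
    rw [ha, pow_add, inv_mul_le_iff₀ (by positivity)]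
    linarith
  have hlog : #S * Real.log 2 ≤ #S / 8 + d * ((T + 3) * Real.log 2) := by
    have hlog_a : Real.log a = -((T + 3) * Real.log 2) := by
      rw [ha, Real.log_inv, Real.log_pow]
      push_cast
      rfl
    have := Real.log_le_log (by positivity) hgrowth
    rw [Real.log_exp, Real.log_pow, hlog_a] at this
    linarith
  have hT : (d : ℝ) * (T + 3) ≤ 4 * (T * d) := by
    have : (1 : ℝ) ≤ T := Nat.one_le_cast.2 T.pos
    nlinarith [(Nat.cast_nonneg d : (0 : ℝ) ≤ d)]
  have hreal : (#S : ℝ) ≤ 6 * T * d := by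
    nlinarith [Real.log_two_gt_d9, Real.log_two_lt_d9]
  exact_mod_cast hreal

theorem VCdim_endToEndClass_le (F : Set (List Bool → Bool)) (T : ℕ+) :
    VCdim (endToEndClass F T) ≤ 6 * ((T : ℕ) : ℕ∞) * VCdim F := by
  obtain htop | hfin := eq_or_ne (VCdim F) ⊤
  · simp [htop, ENat.mul_top]
  · obtain ⟨d, hd⟩ := ENat.ne_top_iff_exists.1 hfin
    rw [← hd]
    exact VCdim_le fun S hS => by exact_mod_cast card_le_of_shatters_endToEndClass hd.ge hS

section Exchange

variable {X ι : Type*}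

/-- Exchange the two entries of the double sample `z` at the positions selected by `σ`. -/
def exchange (σ : ι → Bool) (z : ι → X × X) : ι → X × X :=
  fun i => if σ i then (z i).swap else z i

variable [Fintype ι]

open scoped Classical in
/-- The points occurring in a double sample. -/
noncomputable def samplePoints (z : ι → X × X) : Finset X :=
  univ.image (fun i => (z i).1) ∪ univ.image (fun i => (z i).2)

theorem card_samplePoints_le (z : ι → X × X) : #(samplePoints z) ≤ 2 * Fintype.card ι := by
  classical
  rw [two_mul]
  exact (card_union_le _ _).trans (add_le_add card_image_le card_image_le)

theorem exchange_mem_samplePoints (σ : ι → Bool) (z : ι → X × X) (i : ι) :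
    (exchange σ z i).1 ∈ samplePoints z ∧ (exchange σ z i).2 ∈ samplePoints z := by
  classical
  cases h : σ i <;> simp [exchange, samplePoints, h]

/-- The double samples on which some `h ∈ H` is `false` on the first sample, but `true` at `k` or
more positions of the second, the ghost sample. -/
def ghostFailures (H : Set (X → Bool)) (k : ℕ) : Set (ι → X × X) :=
  {z | ∃ h ∈ H, (∀ i, h (z i).1 = false) ∧ k ≤ #{i | h (z i).2 = true}}

variable [DecidableEq ι]

/-- Weight each `σ` by `0` if `h` hits the first sample, and by `2 ^ n` for `n` hits on the second
otherwise: the weight factors over the positions, and the two orders of a pair have total weight at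
most `2`. -/
theorem card_exchange_mul_two_pow_le (h : X → Bool) (k : ℕ) (z : ι → X × X) :
    #{σ : ι → Bool | (∀ i, h (exchange σ z i).1 = false) ∧
      k ≤ #{i | h (exchange σ z i).2 = true}} * 2 ^ k ≤ 2 ^ Fintype.card ι := by
  let weight (p : X × X) : ℕ := if h p.1 = true then 0 else if h p.2 = true then 2 else 1
  have hpair (p : X × X) : weight p.swap + weight p ≤ 2 := by
    cases h1 : h p.1 <;> cases h2 : h p.2 <;> simp [weight, h1, h2]
  rw [← smul_eq_mul]
  calc _ ≤ ∑ σ : ι → Bool with (∀ i, h (exchange σ z i).1 = false) ∧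
            k ≤ #{i | h (exchange σ z i).2 = true}, ∏ i, weight (exchange σ z i) := by
        refine card_nsmul_le_sum _ _ _ fun σ hσ => ?_
        obtain ⟨hfst, hsnd⟩ := (mem_filter.1 hσ).2
        simp only [weight, hfst, Bool.false_eq_true, if_false, prod_ite, prod_const, one_pow,
          mul_one]
        exact Nat.pow_le_pow_right two_pos hsnd
    _ ≤ ∑ σ : ι → Bool, ∏ i, weight (exchange σ z i) :=
        sum_le_sum_of_subset (filter_subset _ _)
    _ = ∏ i, ∑ b : Bool, weight (if b then (z i).swap else z i) := by
        rw [prod_univ_sum, Fintype.piFinset_univ]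
        rfl
    _ ≤ ∏ _i : ι, 2 := prod_le_prod' fun i _ => by simpa using hpair (z i)
    _ = 2 ^ Fintype.card ι := by rw [prod_const, card_univ]

open scoped Classical in
theorem card_exchange_mem_ghostFailures_le (H : Set (X → Bool)) (k : ℕ) (z : ι → X × X) :
    #{σ : ι → Bool | exchange σ z ∈ ghostFailures H k} * 2 ^ k ≤
      #(traces H (samplePoints z)) * 2 ^ Fintype.card ι := by
  let failing (A : Finset X) : Finset (ι → Bool) :=
    {σ | (∀ i, decide ((exchange σ z i).1 ∈ A) = false) ∧
      k ≤ #{i | decide ((exchange σ z i).2 ∈ A) = true}}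
  have hcover : ({σ | exchange σ z ∈ ghostFailures H k} : Finset (ι → Bool)) ⊆
      (traces H (samplePoints z)).biUnion failing := by
    intro σ hσ
    obtain ⟨h, hH, hfst, hsnd⟩ := (mem_filter.1 hσ).2
    refine mem_biUnion.2 ⟨_, mem_traces.2 ⟨h, hH, rfl⟩, mem_filter.2 ⟨mem_univ _, ?_⟩⟩
    simp only [mem_filter, exchange_mem_samplePoints, true_and, Bool.decide_eq_true]
    exact ⟨hfst, hsnd⟩
  calc _ ≤ (∑ A ∈ traces H (samplePoints z), #(failing A)) * 2 ^ k :=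
        Nat.mul_le_mul_right _ ((card_le_card hcover).trans card_biUnion_le)
    _ = ∑ A ∈ traces H (samplePoints z), #(failing A) * 2 ^ k := sum_mul _ _ _
    _ ≤ #(traces H (samplePoints z)) * 2 ^ Fintype.card ι :=
        sum_le_card_nsmul _ _ _ fun A _ =>
          card_exchange_mul_two_pow_le (fun x => decide (x ∈ A)) k z

end Exchange

open scoped Classical in
/-- A set has the same measure as the average of its preimages, whose indicators average to at
most `C / card κ` at each point. -/
theorem card_mul_measureReal_le {κ Ω : Type*} [Fintype κ] [MeasurableSpace Ω] {ν : Measure Ω}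
    [IsProbabilityMeasure ν] {φ : κ → Ω → Ω} (hφ : ∀ j, MeasurePreserving (φ j) ν ν) {B : Set Ω}
    (hB : MeasurableSet B) {C : ℝ} (hC : ∀ ω, (#{j | φ j ω ∈ B} : ℝ) ≤ C) :
    Fintype.card κ * ν.real B ≤ C := by
  have hpre (j : κ) : MeasurableSet (φ j ⁻¹' B) := (hφ j).measurable hB
  have hint (j : κ) : Integrable ((φ j ⁻¹' B).indicator (1 : Ω → ℝ)) ν :=
    (integrable_const (1 : ℝ)).indicator (hpre j)
  calc Fintype.card κ * ν.real B
      = ∑ j, ν.real (φ j ⁻¹' B) := by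
        simp only [(hφ _).measureReal_preimage hB.nullMeasurableSet, sum_const, card_univ,
          nsmul_eq_mul]
    _ = ∫ ω, ∑ j, (φ j ⁻¹' B).indicator (1 : Ω → ℝ) ω ∂ν := by
        rw [integral_finsetSum _ fun j _ => hint j]
        exact sum_congr rfl fun j _ => (integral_indicator_one (hpre j)).symm
    _ ≤ ∫ _, C ∂ν := by
        refine integral_mono (integrable_finsetSum _ fun j _ => hint j) (integrable_const C) ?_
        intro ω
        simpa [Set.indicator_apply] using hC ω
    _ = C := by simp

section Probability

variable {X ι : Type*} [MeasurableSpace X] [Fintype ι]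

theorem measurable_card_hits {h : X → Bool} (hh : Measurable h) :
    Measurable fun x : ι → X => #{i | h (x i) = true} := by
  simp only [card_filter]
  refine measurable_sum _ fun i _ => ?_
  exact (Measurable.of_discrete (f := fun b : Bool => if b = true then 1 else 0)).comp
    (hh.comp (measurable_pi_apply i))

variable (D : Measure X) [IsProbabilityMeasure D]

theorem measurePreserving_exchange (σ : ι → Bool) :
    MeasurePreserving (exchange σ) (Measure.pi fun _ => D.prod D)
      (Measure.pi fun _ => D.prod D) := by
  refine measurePreserving_pi _ _ (f := fun i (p : X × X) => if σ i then p.swap else p) fun i => ?_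
  cases σ i
  · exact .id _
  · exact Measure.measurePreserving_swap

theorem measureReal_ghostFailures_le {H : Set (X → Bool)} {k : ℕ}
    (hmeas : MeasurableSet (ghostFailures (ι := ι) H k)) {G : ℝ}
    (hG : ∀ z : ι → X × X, (#(traces H (samplePoints z)) : ℝ) ≤ G) :
    (Measure.pi fun _ : ι => D.prod D).real (ghostFailures H k) ≤ G / 2 ^ k := by
  classical
  have havg := card_mul_measureReal_le (measurePreserving_exchange D) hmeas
    (C := G * 2 ^ Fintype.card ι / 2 ^ k) fun z => by
      rw [le_div_iff₀ (by positivity)]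
      calc _ ≤ (#(traces H (samplePoints z)) : ℝ) * 2 ^ Fintype.card ι := by
            exact_mod_cast card_exchange_mem_ghostFailures_le H k z
        _ ≤ G * 2 ^ Fintype.card ι := by
            gcongr
            exact hG z
  rw [Fintype.card_fun, Fintype.card_bool, mul_comm G, mul_div_assoc] at havg
  push_cast at havg
  exact le_of_mul_le_mul_left havg (by positivity)

theorem integral_pow_card_hits {h : X → Bool} (hh : Measurable h) (r : ℝ) :
    ∫ x : ι → X, r ^ #{i | h (x i) = true} ∂Measure.pi (fun _ => D) =
      (1 + (r - 1) * D.real {x | h x = true}) ^ Fintype.card ι := by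
  have hmeas : MeasurableSet {x | h x = true} := hh (measurableSet_singleton true)
  have hfactor (x : ι → X) :
      r ^ #{i | h (x i) = true} = ∏ i, if h (x i) = true then r else 1 := by
    rw [← prod_filter, prod_const]
  have hsingle : ∫ x, (if h x = true then r else 1) ∂D = 1 + (r - 1) * D.real {x | h x = true} := by
    have hind (x : X) : (if h x = true then r else 1) =
        1 + {x | h x = true}.indicator (fun _ => r - 1) x := by
      by_cases hx : h x = true <;> simp [hx]
    simp only [hind]
    rw [integral_add (integrable_const _) ((integrable_const _).indicator hmeas),
      integral_indicator_const _ hmeas]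
    simp [mul_comm]
  simp only [hfactor]
  rw [integral_fintype_prod_eq_pow (fun x => if h x = true then r else 1), hsingle]

/-- Markov's inequality for `2 ^ (-N)`, where `N` is the number of hits. -/
theorem measureReal_card_hits_le_le {h : X → Bool} (hh : Measurable h) (s : ℝ) :
    (Measure.pi fun _ : ι => D).real {x | (#{i | h (x i) = true} : ℝ) ≤ s} ≤
      Real.exp (Real.log 2 * s - D.real {x | h x = true} / 2 * Fintype.card ι) := by
  set μ := Measure.pi fun _ : ι => D
  set p := D.real {x | h x = true} with hp
  have hint : Integrable (fun x : ι → X => (1 / 2 : ℝ) ^ #{i | h (x i) = true}) μ := by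
    refine .of_bound (Measurable.of_discrete.comp (measurable_card_hits hh)).aestronglyMeasurable 1
      (.of_forall ?_)
    intro x
    rw [Real.norm_of_nonneg (by positivity)]
    exact pow_le_one₀ (by norm_num) (by norm_num)
  have hsub : {x : ι → X | (#{i | h (x i) = true} : ℝ) ≤ s} ⊆
      {x | Real.exp (-(Real.log 2 * s)) ≤ (1 / 2 : ℝ) ^ #{i | h (x i) = true}} := by
    intro x hx
    rw [Set.mem_ofPred_eq] at hx ⊢
    rw [← Real.rpow_natCast, Real.rpow_def_of_pos (by norm_num), one_div, Real.log_inv,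
      Real.exp_le_exp]
    nlinarith [Real.log_pos one_lt_two]
  have hmarkov := mul_meas_ge_le_integral_of_nonneg
    (.of_forall fun x => by positivity) hint (Real.exp (-(Real.log 2 * s)))
  rw [integral_pow_card_hits D hh, ← hp, mul_comm, ← le_div_iff₀ (Real.exp_pos _)] at hmarkov
  calc μ.real {x | (#{i | h (x i) = true} : ℝ) ≤ s}
      ≤ (1 + (1 / 2 - 1) * p) ^ Fintype.card ι / Real.exp (-(Real.log 2 * s)) :=
        (measureReal_mono hsub).trans hmarkov
    _ ≤ Real.exp (-(p / 2)) ^ Fintype.card ι / Real.exp (-(Real.log 2 * s)) := by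
        have hp1 : p ≤ 1 := measureReal_le_one
        gcongr
        · linarith
        · linarith [Real.one_sub_le_exp_neg (p / 2)]
    _ = Real.exp (Real.log 2 * s - p / 2 * Fintype.card ι) := by
        rw [← Real.exp_nat_mul, ← Real.exp_sub]
        ring_nf

theorem half_le_measureReal_le_card_hits {h : X → Bool} (hh : Measurable h) {ε : ℝ}
    (hε : ε ≤ D.real {x | h x = true}) (hm : 4 ≤ ε * Fintype.card ι) :
    1 / 2 ≤ (Measure.pi fun _ : ι => D).real
      {x | ⌈ε * Fintype.card ι / 4⌉₊ ≤ #{i | h (x i) = true}} := by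
  have hsub : {x : ι → X | ⌈ε * Fintype.card ι / 4⌉₊ ≤ #{i | h (x i) = true}}ᶜ ⊆
      {x | (#{i | h (x i) = true} : ℝ) ≤ ε * Fintype.card ι / 4} :=
    fun x hx => (Nat.lt_ceil.1 (not_le.1 hx)).le
  have hcompl : (Measure.pi fun _ : ι => D).real
      {x | ⌈ε * Fintype.card ι / 4⌉₊ ≤ #{i | h (x i) = true}}ᶜ ≤ 1 / 2 := by
    refine ((measureReal_mono hsub).trans (measureReal_card_hits_le_le D hh _)).trans ?_
    rw [one_div, ← Real.exp_log two_pos, ← Real.exp_neg, Real.exp_le_exp, Real.exp_log two_pos]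
    have := mul_le_mul_of_nonneg_right hε (Nat.cast_nonneg (α := ℝ) (Fintype.card ι))
    nlinarith [Real.log_two_lt_d9]
  have htotal := measureReal_union_le (μ := Measure.pi fun _ : ι => D)
    {x | ⌈ε * Fintype.card ι / 4⌉₊ ≤ #{i | h (x i) = true}}
    {x | ⌈ε * Fintype.card ι / 4⌉₊ ≤ #{i | h (x i) = true}}ᶜ
  rw [Set.union_compl_self, probReal_univ] at htotal
  linarith

/-- The samples that are not an `ε`-net for `H` with respect to `D`: they miss some `h ∈ H` of
measure more than `ε`. -/
def netFailures (H : Set (X → Bool)) (ε : ℝ) : Set (ι → X) :=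
  {x | ∃ h ∈ H, (∀ i, h (x i) = false) ∧ ε < D.real {y | h y = true}}

theorem measureReal_netFailures_le_two_mul {H : Set (X → Bool)} (hH : ∀ h ∈ H, Measurable h)
    {ε : ℝ} (hm : 4 ≤ ε * Fintype.card ι)
    (hmeas : MeasurableSet (ghostFailures (ι := ι) H ⌈ε * Fintype.card ι / 4⌉₊)) :
    (Measure.pi fun _ : ι => D).real (netFailures D H ε) ≤
      2 * (Measure.pi fun _ : ι => D.prod D).real
        (ghostFailures H ⌈ε * Fintype.card ι / 4⌉₊) := by
  set μ := Measure.pi fun _ : ι => D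
  set B : Set (ι → X × X) := ghostFailures H ⌈ε * Fintype.card ι / 4⌉₊
  have hunzip := (measurePreserving_arrowProdEquivProdArrow X X ι (fun _ => D) fun _ => D).symm
  set unzip := MeasurableEquiv.arrowProdEquivProdArrow X X ι
  have hslice : netFailures D H ε ⊆
      {x | ENNReal.ofReal (1 / 2) ≤ μ (Prod.mk x ⁻¹' (unzip.symm ⁻¹' B))} := by
    rintro x ⟨h, hhH, hfst, hε⟩
    have hsnd := half_le_measureReal_le_card_hits (ι := ι) D (hH h hhH) hε.le hm
    refine ((ENNReal.ofReal_le_iff_le_toReal (measure_ne_top _ _)).2 hsnd).trans ?_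
    exact measure_mono fun y hy => ⟨h, hhH, hfst, hy⟩
  have hle : ENNReal.ofReal (1 / 2) * μ (netFailures D H ε) ≤
      (Measure.pi fun _ : ι => D.prod D) B := by
    rw [← hunzip.measure_preimage_equiv, Measure.prod_apply (unzip.symm.measurable hmeas)]
    refine le_trans ?_ (mul_meas_ge_le_lintegral
      (measurable_measure_prodMk_left (unzip.symm.measurable hmeas)) (ENNReal.ofReal (1 / 2)))
    gcongr
  have hreal := ENNReal.toReal_mono (measure_ne_top _ _) hle
  rw [ENNReal.toReal_mul, ENNReal.toReal_ofReal (by norm_num)] at hreal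
  simp only [Measure.real]
  linarith

theorem measureReal_netFailures_le {H : Set (X → Bool)} (hH : ∀ h ∈ H, Measurable h) {d : ℕ}
    (hd : VCdim H ≤ d) {ε : ℝ} (hε : 0 < ε) (hε1 : ε ≤ 1) (hm : 4 ≤ ε * Fintype.card ι)
    (hmeas : MeasurableSet (ghostFailures (ι := ι) H ⌈ε * Fintype.card ι / 4⌉₊)) :
    (Measure.pi fun _ : ι => D).real (netFailures D H ε) ≤
      2 * Real.exp (d * Real.log (32 / ε) - ε * Fintype.card ι / 10) := by
  set m : ℝ := (Fintype.card ι : ℝ) with hm_def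
  have hlog : Real.log (ε / 32) = -Real.log (32 / ε) := by rw [← Real.log_inv, inv_div]
  have hgrowth (z : ι → X × X) : (#(traces H (samplePoints z)) : ℝ) ≤
      Real.exp (ε * m / 16 + d * Real.log (32 / ε)) := by
    refine (card_traces_le_exp hd (a := ε / 32) (by positivity) (by linarith)).trans ?_
    have hcard : (#(samplePoints z) : ℝ) ≤ 2 * m := by
      rw [hm_def]
      exact_mod_cast card_samplePoints_le z
    rw [hlog, Real.exp_le_exp]
    have := mul_le_mul_of_nonneg_left hcard hε.le
    linarith
  have htwo_pow : Real.exp (Real.log 2 * (ε * m / 4)) ≤ 2 ^ ⌈ε * m / 4⌉₊ := by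
    rw [← Real.rpow_natCast, Real.rpow_def_of_pos two_pos]
    gcongr
    exact Nat.le_ceil _
  calc _ ≤ 2 * (Real.exp (ε * m / 16 + d * Real.log (32 / ε)) / 2 ^ ⌈ε * m / 4⌉₊) := by
        refine (measureReal_netFailures_le_two_mul D hH hm hmeas).trans ?_
        gcongr
        exact measureReal_ghostFailures_le D hmeas hgrowth
    _ ≤ 2 * (Real.exp (ε * m / 16 + d * Real.log (32 / ε)) /
          Real.exp (Real.log 2 * (ε * m / 4))) := by gcongr
    _ ≤ 2 * Real.exp (d * Real.log (32 / ε) - ε * m / 10) := by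
        rw [← Real.exp_sub]
        gcongr 2 * Real.exp ?_
        nlinarith [Real.log_two_gt_d9]

end Probability

/-- The members of `H`, each replaced by the indicator of the set where it differs from `t`: the
sets that a sample labelled by `t` must hit for every consistent predictor to be accurate. -/
def disagreementClass {X : Type*} (H : Set (X → Bool)) (t : X → Bool) : Set (X → Bool) :=
  (fun h x => h x != t x) '' H

theorem VCdim_disagreementClass_le {X : Type*} (H : Set (X → Bool)) (t : X → Bool) :
    VCdim (disagreementClass H t) ≤ VCdim H := by
  refine VCdim_le fun S hS => Shatters.card_le_VCdim fun b => ?_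
  obtain ⟨_, ⟨h, hH, rfl⟩, hb⟩ := hS fun x => b x != t x
  exact ⟨h, hH, fun x => by simpa using hb x⟩

/-- A sample size sufficient for consistent learning of a class of VC dimension at most `d`.
Rounding up would break the bound `consSampleSize_le` when `d = 0` and `δ` is close to `1`. -/
noncomputable def consSampleSize (d : ℕ) (ε δ : ℝ) : ℕ :=
  ⌊10 / ε * (2 * d * Real.log (32 / ε) + Real.log δ⁻¹)⌋₊

theorem log_div_le_mul_log_inv {b ε₀ ε : ℝ} (hb : 1 ≤ b) (hε : 0 < ε) (hε₀ : ε ≤ ε₀)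
    (hε₀1 : ε₀ < 1) :
    Real.log (b / ε) ≤ (1 + Real.log b / Real.log ε₀⁻¹) * Real.log ε⁻¹ := by
  have hε₀0 : 0 < ε₀ := hε.trans_le hε₀
  have hlogε₀ : 0 < Real.log ε₀⁻¹ := Real.log_pos ((one_lt_inv₀ hε₀0).2 hε₀1)
  have hmono : Real.log ε₀⁻¹ ≤ Real.log ε⁻¹ :=
    Real.log_le_log (inv_pos.2 hε₀0) (inv_anti₀ hε hε₀)
  calc Real.log (b / ε) = Real.log ε⁻¹ + Real.log b / Real.log ε₀⁻¹ * Real.log ε₀⁻¹ := by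
        rw [div_mul_cancel₀ _ hlogε₀.ne', div_eq_inv_mul,
          Real.log_mul (inv_ne_zero hε.ne') (by positivity)]
    _ ≤ Real.log ε⁻¹ + Real.log b / Real.log ε₀⁻¹ * Real.log ε⁻¹ := by
        have := Real.log_nonneg hb
        gcongr
    _ = (1 + Real.log b / Real.log ε₀⁻¹) * Real.log ε⁻¹ := by ring

theorem consSampleSize_le {d : ℕ} {ε₀ ε δ : ℝ} (hε : 0 < ε) (hε₀ : ε ≤ ε₀) (hε₀1 : ε₀ < 1)
    (hδ : 0 < δ) (hδ1 : δ < 1) :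
    (consSampleSize d ε δ : ℝ) ≤
      20 * (1 + Real.log 32 / Real.log ε₀⁻¹) * (ε⁻¹ * (d * Real.log ε⁻¹ + Real.log δ⁻¹)) := by
  have hlogδ : 0 ≤ Real.log δ⁻¹ := Real.log_nonneg ((one_le_inv₀ hδ).2 hδ1.le)
  have hlogε₀ : 0 ≤ Real.log ε₀⁻¹ :=
    Real.log_nonneg ((one_le_inv₀ (hε.trans_le hε₀)).2 hε₀1.le)
  have hlogε : 0 ≤ Real.log (32 / ε) := Real.log_nonneg (by rw [one_le_div hε]; linarith)
  set C := 1 + Real.log 32 / Real.log ε₀⁻¹ with hC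
  have hC1 : 1 ≤ C := by rw [hC, le_add_iff_nonneg_right]; positivity
  calc (consSampleSize d ε δ : ℝ) ≤ 10 / ε * (2 * d * Real.log (32 / ε) + Real.log δ⁻¹) :=
        Nat.floor_le (by positivity)
    _ ≤ 10 / ε * (2 * d * (C * Real.log ε⁻¹) + 2 * C * Real.log δ⁻¹) := by
        gcongr
        · exact log_div_le_mul_log_inv (by norm_num) hε hε₀ hε₀1
        · nlinarith
    _ = 20 * C * (ε⁻¹ * (d * Real.log ε⁻¹ + Real.log δ⁻¹)) := by ring

theorem lt_mul_consSampleSize {d : ℕ} {ε δ : ℝ} (hε : 0 < ε) (hε1 : ε < 1) :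
    10 * (2 * d * Real.log (32 / ε) + Real.log δ⁻¹) - 1 < ε * consSampleSize d ε δ := by
  have hfloor := mul_lt_mul_of_pos_left
    (Nat.lt_floor_add_one (10 / ε * (2 * d * Real.log (32 / ε) + Real.log δ⁻¹))) hε
  rw [← mul_assoc, mul_div_cancel₀ _ hε.ne'] at hfloor
  rw [consSampleSize]
  linarith

theorem three_le_mul_log_div {d : ℕ} (hd : d ≠ 0) {ε : ℝ} (hε : 0 < ε) (hε1 : ε < 1) :
    3 ≤ d * Real.log (32 / ε) := by
  have hd1 : (1 : ℝ) ≤ d := Nat.one_le_cast.2 (Nat.one_le_iff_ne_zero.2 hd)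
  have hlog : Real.log (2 ^ 5) ≤ Real.log (32 / ε) :=
    Real.log_le_log (by norm_num) ((le_div_iff₀ hε).2 (by linarith))
  rw [Real.log_pow] at hlog
  push_cast at hlog
  nlinarith [Real.log_two_gt_d9]

theorem measureReal_netFailures_consSampleSize_le {X : Type*} [MeasurableSpace X]
    [DiscreteMeasurableSpace X] [Countable X] (D : Measure X) [IsProbabilityMeasure D]
    {H : Set (X → Bool)} {d : ℕ} (hVC : VCdim H ≤ d) (hd : d ≠ 0) {ε δ : ℝ}
    (hε : 0 < ε) (hε1 : ε < 1) (hδ : 0 < δ) (hδ1 : δ < 1) :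
    (Measure.pi fun _ : Fin (consSampleSize d ε δ) => D).real (netFailures D H ε) ≤ δ := by
  have hlogδ : 0 ≤ Real.log δ⁻¹ := Real.log_nonneg ((one_le_inv₀ hδ).2 hδ1.le)
  have hlogd := three_le_mul_log_div hd hε hε1
  have hm := lt_mul_consSampleSize (d := d) (δ := δ) hε hε1
  refine (measureReal_netFailures_le D (fun _ _ => .of_discrete) hVC hε hε1.le
    (by rw [Fintype.card_fin]; linarith) .of_discrete).trans ?_
  rw [Fintype.card_fin]
  calc 2 * Real.exp (d * Real.log (32 / ε) - ε * consSampleSize d ε δ / 10)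
      = Real.exp (Real.log 2 + (d * Real.log (32 / ε) - ε * consSampleSize d ε δ / 10)) := by
        rw [Real.exp_add, Real.exp_log two_pos]
    _ ≤ Real.exp (Real.log δ) := by
        rw [Real.log_inv] at hm
        rw [Real.exp_le_exp]
        linarith [Real.log_two_lt_d9]
    _ = δ := Real.exp_log hδ

theorem exists_isConsRule (F : Set (List Bool → Bool)) (T : ℕ+) :
    ∃ A : LearningRule, IsConsRule F T A := by
  classical
  exact ⟨fun S => if h : ∃ f ∈ F, ∀ p ∈ S, endToEnd f T p.1 = p.2 then endToEnd h.choose T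
    else fun _ => false, fun S hS => ⟨hS.choose, hS.choose_spec.1, dif_pos hS, hS.choose_spec.2⟩⟩

theorem IsConsRule.apply_labelledSample {F : Set (List Bool → Bool)} {T : ℕ+} {A : LearningRule}
    (hA : IsConsRule F T A) {f : List Bool → Bool} (hf : f ∈ F) {m : ℕ} (x : Fin m → List Bool) :
    A (labelledSample f T x) ∈ endToEndClass F T ∧
      ∀ i, A (labelledSample f T x) (x i) = endToEnd f T (x i) := by
  obtain ⟨g, hg, hAg, hcons⟩ := hA (labelledSample f T x) ⟨f, hf, by
    intro p hp
    obtain ⟨i, rfl⟩ := List.mem_ofFn.1 hp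
    rfl⟩
  rw [hAg]
  exact ⟨⟨g, hg, rfl⟩, fun i => hcons (x i, endToEnd f T (x i)) (List.mem_ofFn.2 ⟨i, rfl⟩)⟩

theorem IsConsRule.learnsEndToEnd {F : Set (List Bool → Bool)} {T : ℕ+} {d : ℕ}
    (hVC : VCdim (endToEndClass F T) ≤ d) {A : LearningRule} (hA : IsConsRule F T A) :
    LearnsEndToEnd F T A (consSampleSize d) := by
  intro D _ f hf ε δ hε hε1 hδ hδ1
  obtain rfl | hd := eq_or_ne d 0
  · have hexact (m : ℕ) (x : Fin m → List Bool) : A (labelledSample f T x) = endToEnd f T :=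
      subsingleton_of_VCdim_eq_zero (le_antisymm hVC zero_le) (hA.apply_labelledSample hf x).1
        ⟨f, hf, rfl⟩
    simp [populationError, hexact, hε.le, hδ.le]
  · have hfail := measureReal_netFailures_consSampleSize_le D
      ((VCdim_disagreementClass_le _ (endToEnd f T)).trans hVC) hd hε hε1 hδ hδ1
    rw [← sub_le_sub_iff_left 1, ← probReal_compl_eq_one_sub .of_discrete] at hfail
    refine hfail.trans (measureReal_mono fun x hx => ?_)
    by_contra hlt
    refine hx ?_
    obtain ⟨hmem, hagree⟩ := hA.apply_labelledSample hf x
    refine ⟨_, ⟨_, hmem, rfl⟩, fun i => bne_eq_false_iff_eq.2 (hagree i), ?_⟩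
    simpa only [populationError, bne_iff_ne] using not_le.1 hlt

end AutoregressiveCoT

theorem mainTheorem3 :
    (∀ (F : Set (List Bool → Bool)) (T : ℕ+),
      AutoregressiveCoT.VCdim (AutoregressiveCoT.endToEndClass F T) ≤
        6 * ((T : ℕ) : ℕ∞) * AutoregressiveCoT.VCdim F) ∧
    (∀ ε₀ : ℝ, 0 < ε₀ → ε₀ < 1 →
      ∃ c : ℝ, 0 < c ∧
        ∀ (F : Set (List Bool → Bool)) (T : ℕ+) (d : ℕ), AutoregressiveCoT.VCdim F = (d : ℕ∞) →
          ∃ m : ℝ → ℝ → ℕ,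
            (∀ ε δ : ℝ, 0 < ε → ε ≤ ε₀ → 0 < δ → δ < 1 →
              (m ε δ : ℝ) ≤
                c * (ε⁻¹ * (((T : ℕ) : ℝ) * (d : ℝ) * Real.log ε⁻¹ + Real.log δ⁻¹))) ∧
            (∃ A : AutoregressiveCoT.LearningRule, AutoregressiveCoT.IsConsRule F T A) ∧
            (∀ A : AutoregressiveCoT.LearningRule, AutoregressiveCoT.IsConsRule F T A →
              AutoregressiveCoT.LearnsEndToEnd F T A m)) := by
  refine ⟨AutoregressiveCoT.VCdim_endToEndClass_le, fun ε₀ hε₀ hε₀1 => ?_⟩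
  have hlogε₀ : 0 ≤ Real.log ε₀⁻¹ := Real.log_nonneg ((one_le_inv₀ hε₀).2 hε₀1.le)
  refine ⟨6 * (20 * (1 + Real.log 32 / Real.log ε₀⁻¹)), by positivity, fun F T d hd => ?_⟩
  have hVC : AutoregressiveCoT.VCdim (AutoregressiveCoT.endToEndClass F T) ≤
      ((6 * T * d : ℕ) : ℕ∞) := by
    exact_mod_cast hd ▸ AutoregressiveCoT.VCdim_endToEndClass_le F T
  refine ⟨AutoregressiveCoT.consSampleSize (6 * T * d), fun ε δ hε hεε₀ hδ hδ1 => ?_,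
    AutoregressiveCoT.exists_isConsRule F T, fun A hA => hA.learnsEndToEnd hVC⟩
  have hlogδ : 0 ≤ Real.log δ⁻¹ := Real.log_nonneg ((one_le_inv₀ hδ).2 hδ1.le)
  calc (AutoregressiveCoT.consSampleSize (6 * T * d) ε δ : ℝ)
      ≤ 20 * (1 + Real.log 32 / Real.log ε₀⁻¹) *
          (ε⁻¹ * ((6 * T * d : ℕ) * Real.log ε⁻¹ + Real.log δ⁻¹)) :=
        AutoregressiveCoT.consSampleSize_le hε hεε₀ hε₀1 hδ hδ1
    _ ≤ 20 * (1 + Real.log 32 / Real.log ε₀⁻¹) *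
          (ε⁻¹ * (6 * (T * d * Real.log ε⁻¹ + Real.log δ⁻¹))) := by
        gcongr
        push_cast
        linarith
    _ = 6 * (20 * (1 + Real.log 32 / Real.log ε₀⁻¹)) *
          (ε⁻¹ * (T * d * Real.log ε⁻¹ + Real.log δ⁻¹)) := by ring
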